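/- There exists an absolute constant $c>0$ such that the following holds. Let $d\ge 1$ and $m$ be integers, let $0<\alpha,\gamma<1$, let $\beta^*\in\mathbb{R}^d$, let $\Sigma\in\mathbb{R}^{d\times d}$ be a symmetric positive definite matrix, and let $S=(\beta_1,\dots,\beta_m)$ be an i.i.d. sample from the multivariate normal distribution $\mathcal{N}(\beta^*,\Sigma)$ with mean $\beta^*$ and covariance $\Sigma$. If $$m \;\ge\; c\,\frac{d+\log(1/\gamma)}{\alpha^2},$$ then there is an event of probability at least $1-\gamma$ on which, for every real number $p$ and every point $\hat\beta\in\mathbb{R}^d$ with Tukey depth $T_S(\hat\beta)\ge p$, $$\|\hat\beta-\beta^*\|_\Sigma \;\le\; \Phi^{-1}\!\left(1-\frac{p}{m}+\alpha\right).$$ Here the Tukey depth $T_S(y)$ of $y$ with respect to $S$ is the minimum, over all closed halfspaces $H=\{x\in\mathbb{R}^d : \langle v,x\rangle\ge t\}$ ($v\ne 0$, $t\in\mathbb{R}$) containing $y$, of the number of indices $i$ with $\beta_i\in H$; $\|x\|_\Sigma=\sqrt{x^{\top}\Sigma^{-1}x}$ is the Mahalanobis norm; and $\Phi$ is the CDF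 of the standard univariate Gaussian, with $\Phi^{-1}(q)=+\infty$ for $q\ge 1$. -/

import Mathlib

open MeasureTheory ProbabilityTheory
open scoped Matrix

noncomputable section

/-- The closed affine halfspace `{y | ⟨v, y⟩ ≥ t}` of `ℝ^d` (used with `v ≠ 0`). -/
def closedHalfspace {d : ℕ} (v : EuclideanSpace ℝ (Fin d)) (t : ℝ) :
    Set (EuclideanSpace ℝ (Fin d)) :=
  {y | t ≤ inner ℝ v y}

open Classical in
/-- The number of points of the collection `D` (counted with multiplicity) that lie in `H`. -/
def countIn {d m : ℕ} (D : Fin m → EuclideanSpace ℝ (Fin d))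
    (H : Set (EuclideanSpace ℝ (Fin d))) : ℕ :=
  (Finset.univ.filter fun i => D i ∈ H).card

/-- The (exact, unnormalized) Tukey depth of `y` with respect to the collection `D`: the minimum
number of points of `D` in a closed halfspace that contains `y`. -/
def tukeyDepth {d m : ℕ} (D : Fin m → EuclideanSpace ℝ (Fin d))
    (y : EuclideanSpace ℝ (Fin d)) : ℕ :=
  sInf {k | ∃ (v : EuclideanSpace ℝ (Fin d)) (t : ℝ),
    v ≠ 0 ∧ y ∈ closedHalfspace v t ∧ k = countIn D (closedHalfspace v t)}

/-- The Mahalanobis norm `‖x‖_Σ = √(xᵀ Σ⁻¹ x)`. -/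
def mahalanobisNorm {d : ℕ} (S : Matrix (Fin d) (Fin d) ℝ) (x : EuclideanSpace ℝ (Fin d)) : ℝ :=
  Real.sqrt (x.ofLp ⬝ᵥ (S⁻¹ *ᵥ x.ofLp))

/-- The cumulative distribution function `Φ` of the standard univariate Gaussian. -/
def stdNormalCDF (x : ℝ) : ℝ := cdf (gaussianReal 0 1) x

/-- The inverse `Φ⁻¹ : ℝ → [-∞, ∞]` of the standard normal CDF. It is the inverse function on
`(0, 1)`; as usual for quantile functions, `Φ⁻¹(q) = ∞` for `q ≥ 1` and `Φ⁻¹(q) = -∞` for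
`q ≤ 0`. -/
def stdNormalQuantile (q : ℝ) : EReal :=
  sInf ((fun x : ℝ => (x : EReal)) '' {x : ℝ | q ≤ stdNormalCDF x})

end

/-! Whitening by `S^{-1/2}` turns the sample into a standard Gaussian one and the Mahalanobis norm
into the Euclidean norm. Let `z` be the whitened candidate and `w = z/‖z‖`. The halfspace with
normal `w` and boundary through `z` has Gaussian mass `1 - Φ(‖z‖)`, so if empirical counts of
halfspaces exceed their means by at most `mα/2`, a deep point cannot have large `‖z‖`.

The content is this one-sided uniform bound (`exists_event_quantileCount_le`) with no `log(1/α)`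
loss, which a single net would incur. It is proved by chaining. Halfspaces are indexed by direction
and Gaussian level and approximated at scales `64^{-k}`. Consecutive approximations differ on a set
of mass `O(16^{-k})`, so a Bernstein bound allows error of order `α 2^{-k}` with exponent of order
`mα² 4^k`, which beats the log-cardinality `O(d(k+1))` of the nets. The chain stops once `8^{-K}` is
of order `α`; the remainder is controlled by Markov's inequality and a uniform bound on `∑ |⟨w,
z_i⟩|`. -/

/-! ### Packing and nets of the unit sphere. -/

/-- A `δ`-separated finite subset of the unit ball of a `d`-dimensional normed space has at most
`(1 + 2 / δ) ^ d` elements. -/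
theorem card_le_of_separated_unitBall {E : Type*} [NormedAddCommGroup E] [NormedSpace ℝ E]
    [FiniteDimensional ℝ E] {δ : ℝ} (hδ : 0 < δ) (s : Finset E) (hs : ∀ c ∈ s, ‖c‖ ≤ 1)
    (h : ∀ c ∈ s, ∀ d ∈ s, c ≠ d → δ ≤ ‖c - d‖) :
    (s.card : ℝ) ≤ (1 + 2 / δ) ^ Module.finrank ℝ E := by
  borelize E
  let μ : Measure E := Measure.addHaar
  have ρpos : 0 < 1 + δ / 2 := by positivity
  have δpos : 0 < δ / 2 := by positivity
  -- Volume comparison: the disjoint balls of radius `δ/2` all lie in the ball of radius `1 + δ/2`.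
  have D : Set.Pairwise (s : Set E)
      (Function.onFun Disjoint fun c => Metric.ball (c : E) (δ / 2)) := by
    rintro c hc d hd hcd
    apply Metric.ball_disjoint_ball
    rw [dist_eq_norm]
    linarith [h c hc d hd hcd]
  have A_subset : (⋃ c ∈ s, Metric.ball (c : E) (δ / 2)) ⊆ Metric.ball (0 : E) (1 + δ / 2) := by
    refine Set.iUnion₂_subset fun x hx => Metric.ball_subset_ball' ?_
    rw [dist_zero_right]
    linarith [hs x hx]
  have I : (s.card : ENNReal) * ENNReal.ofReal ((δ / 2) ^ Module.finrank ℝ E) *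
      μ (Metric.ball 0 1) ≤ ENNReal.ofReal ((1 + δ / 2) ^ Module.finrank ℝ E) *
        μ (Metric.ball 0 1) :=
    calc
      _ = μ (⋃ c ∈ s, Metric.ball (c : E) (δ / 2)) := by
        rw [measure_biUnion_finset D fun c _ => measurableSet_ball]
        simp only [μ.addHaar_ball_of_pos _ δpos, Finset.sum_const, nsmul_eq_mul, mul_assoc]
      _ ≤ μ (Metric.ball (0 : E) (1 + δ / 2)) := measure_mono A_subset
      _ = _ := by simp only [μ.addHaar_ball_of_pos _ ρpos]
  have J := (ENNReal.mul_le_mul_iff_left (Metric.measure_ball_pos _ _ zero_lt_one).ne'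
    measure_ball_lt_top.ne).1 I
  have K := ENNReal.toReal_le_of_le_ofReal (by positivity) J
  rw [ENNReal.toReal_mul, ENNReal.toReal_ofReal (by positivity), ENNReal.toReal_natCast] at K
  have e : (1 + 2 / δ) ^ Module.finrank ℝ E * (δ / 2) ^ Module.finrank ℝ E
      = (1 + δ / 2) ^ Module.finrank ℝ E := by
    rw [← mul_pow]
    congr 1
    field_simp
    ring
  rw [← e] at K
  exact le_of_mul_le_mul_right K (by positivity)

/-- The unit sphere has a finite `δ`-net, contained in the sphere, of size `(1 + 2 / δ) ^ d`. -/
theorem exists_sphere_net (E : Type*) [NormedAddCommGroup E] [NormedSpace ℝ E]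
    [FiniteDimensional ℝ E] {δ : ℝ} (hδ : 0 < δ) :
    ∃ T : Finset E, (∀ w ∈ T, ‖w‖ = 1) ∧ (∀ v : E, ‖v‖ = 1 → ∃ w ∈ T, ‖v - w‖ ≤ δ) ∧
      (T.card : ℝ) ≤ (1 + 2 / δ) ^ Module.finrank ℝ E := by
  classical
  let C : Set ℕ := {n | ∃ s : Finset E, (∀ c ∈ s, ‖c‖ = 1) ∧
    (∀ c ∈ s, ∀ d ∈ s, c ≠ d → δ ≤ ‖c - d‖) ∧ s.card = n}
  have hne : C.Nonempty := ⟨0, ∅, by simp, by simp, rfl⟩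
  have hbdd : BddAbove C := by
    refine ⟨⌊(1 + 2 / δ) ^ Module.finrank ℝ E⌋₊, ?_⟩
    rintro n ⟨s, h1, h2, rfl⟩
    exact Nat.le_floor (card_le_of_separated_unitBall hδ s (fun c hc => (h1 c hc).le) h2)
  -- A separated set of maximal cardinality is a net: an uncovered unit vector could be added to it.
  obtain ⟨T, h1, h2, hcard⟩ := Nat.sSup_mem hne hbdd
  refine ⟨T, h1, fun v hv => ?_,
    card_le_of_separated_unitBall hδ T (fun c hc => (h1 c hc).le) h2⟩
  by_contra! hcon
  have hvT : v ∉ T := fun hmem => by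
    have := hcon v hmem
    simp at this
    linarith
  have hmem : (insert v T).card ∈ C := by
    refine ⟨insert v T, ?_, ?_, rfl⟩
    · intro c hc
      rcases Finset.mem_insert.1 hc with rfl | hc
      exacts [hv, h1 c hc]
    · intro c hc d hd hcd
      rcases Finset.mem_insert.1 hc with rfl | hc <;> rcases Finset.mem_insert.1 hd with rfl | hd
      · exact absurd rfl hcd
      · exact (hcon d hd).le
      · rw [norm_sub_rev]; exact (hcon _ ‹_›).le
      · exact h2 c hc d hd hcd
  have := le_csSup hbdd hmem
  rw [Finset.card_insert_of_notMem hvT, hcard] at this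
  omega

/-! ### Exponential deviation bounds for i.i.d. samples. -/

section Chernoff

variable {Ω V : Type*} [MeasurableSpace Ω] [MeasurableSpace V] {P : Measure Ω}
  [IsProbabilityMeasure P] {ν : Measure V} {m : ℕ} {Z : Fin m → Ω → V}

/-- Chernoff bound for a sum of i.i.d. terms `g (Z i)`. -/
theorem measureReal_sum_ge_le_pow (hind : iIndepFun Z P) (hlaw : ∀ i, HasLaw (Z i) ν P)
    {g : V → ℝ} (hg : Measurable g) {t b u : ℝ} (ht : 0 ≤ t)
    (hint : Integrable (fun x => Real.exp (t * g x)) ν)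
    (hb : ∫ x, Real.exp (t * g x) ∂ν ≤ b) :
    P.real {ω | m * u ≤ ∑ i, g (Z i ω)} ≤ (b * Real.exp (-(t * u))) ^ m := by
  have hgi : ∀ i, AEMeasurable (fun ω => g (Z i ω)) P := fun i =>
    hg.comp_aemeasurable (hlaw i).aemeasurable
  have hind' : iIndepFun (fun i ω => g (Z i ω)) P :=
    hind.comp (fun _ => g) (fun _ => hg)
  have hI : ∀ i, Integrable (fun ω => Real.exp (t * g (Z i ω))) P := fun i => by
    have h := hint
    rw [← (hlaw i).map_eq] at h
    exact h.comp_aemeasurable (hlaw i).aemeasurable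
  have hmgf : ∀ i, mgf (fun ω => g (Z i ω)) P t ≤ b := fun i => by
    refine le_trans (le_of_eq ?_) hb
    rw [← (hlaw i).map_eq, integral_map (hlaw i).aemeasurable
      (by rw [(hlaw i).map_eq]; exact hint.aestronglyMeasurable)]
    rfl
  -- A non-integrable exponential would have `mgf` equal to the default value `0`, yet the `mgf` is
  -- a product of positive factors.
  have hsum : Integrable (fun ω => Real.exp (t * (∑ i, fun ω => g (Z i ω)) ω)) P := by
    by_contra hcon
    have h0 : mgf (∑ i, fun ω => g (Z i ω)) P t = 0 := integral_undef hcon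
    rw [hind'.mgf_sum₀ hgi] at h0
    exact (Finset.prod_pos fun i _ => mgf_pos (hI i)).ne' h0
  have key := measure_ge_le_exp_mul_mgf (μ := P) (X := ∑ i, fun ω => g (Z i ω)) (m * u) ht hsum
  rw [hind'.mgf_sum₀ hgi] at key
  simp only [Finset.sum_apply] at key
  refine key.trans ?_
  calc _ ≤ Real.exp (-t * (m * u)) * ∏ _i : Fin m, b := by
        gcongr with i
        · exact fun i _ => mgf_nonneg
        · exact hmgf i
    _ = _ := by
        rw [Finset.prod_const, Finset.card_univ, Fintype.card_fin, mul_pow, ← Real.exp_nat_mul,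
          mul_comm]
        congr 2
        ring

/-- Bernstein-type bound: deviation of the empirical count of `A` minus that of `B` in terms of
the measure of the symmetric difference. -/
theorem measureReal_count_sub_ge_le [IsProbabilityMeasure ν] (hind : iIndepFun Z P)
    (hlaw : ∀ i, HasLaw (Z i) ν P) {A B : Set V} (hA : MeasurableSet A) (hB : MeasurableSet B)
    {s t u : ℝ} (hs : ν.real (symmDiff A B) ≤ s) (ht : 0 ≤ t) (ht1 : t ≤ 1) :
    P.real {ω | m * (ν.real A - ν.real B + u) ≤
      ∑ i, (A.indicator 1 (Z i ω) - B.indicator 1 (Z i ω) : ℝ)} ≤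
      Real.exp (m * (t ^ 2 * s - t * u)) := by
  classical
  let g : V → ℝ := fun x => A.indicator 1 x - B.indicator 1 x
  have hgm : Measurable g := (measurable_one.indicator hA).sub (measurable_one.indicator hB)
  have hg1 : ∀ x, |g x| ≤ 1 := fun x => by
    by_cases h1 : x ∈ A <;> by_cases h2 : x ∈ B <;> simp [g, h1, h2]
  have hg2 : ∀ x, g x ^ 2 = (symmDiff A B).indicator 1 x := fun x => by
    by_cases h1 : x ∈ A <;> by_cases h2 : x ∈ B <;> simp [g, h1, h2, Set.mem_symmDiff]
  have hIA : Integrable (A.indicator (1 : V → ℝ)) ν := (integrable_const 1).indicator hA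
  have hIB : Integrable (B.indicator (1 : V → ℝ)) ν := (integrable_const 1).indicator hB
  have hID : Integrable ((symmDiff A B).indicator (1 : V → ℝ)) ν :=
    (integrable_const 1).indicator (hA.symmDiff hB)
  have hIg : Integrable g ν := hIA.sub hIB
  -- Uses `e^y ≤ 1 + y + y²` for `|y| ≤ 1`. As `g²` is the indicator of the symmetric difference,
  -- the variance term is its mass.
  have hub : ∀ x, Real.exp (t * g x) ≤ 1 + t * g x + t ^ 2 * (symmDiff A B).indicator 1 x := by
    intro x
    have h1 : |t * g x| ≤ 1 := by
      rw [abs_mul, abs_of_nonneg ht]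
      exact mul_le_one₀ ht1 (abs_nonneg _) (hg1 x)
    have := (abs_le.1 (Real.abs_exp_sub_one_sub_id_le h1)).2
    rw [mul_pow, hg2] at this
    linarith
  have hIub : Integrable (fun x => 1 + t * g x + t ^ 2 * (symmDiff A B).indicator 1 x) ν :=
    ((integrable_const 1).add (hIg.const_mul t)).add (hID.const_mul _)
  have hint : Integrable (fun x => Real.exp (t * g x)) ν := by
    refine hIub.mono' (by fun_prop) (ae_of_all _ fun x => ?_)
    rw [Real.norm_eq_abs, Real.abs_exp]
    exact hub x
  have hb : ∫ x, Real.exp (t * g x) ∂ν ≤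
      Real.exp (t * (ν.real A - ν.real B) + t ^ 2 * s) := by
    calc _ ≤ ∫ x, (1 + t * g x + t ^ 2 * (symmDiff A B).indicator 1 x) ∂ν :=
          integral_mono hint hIub hub
      _ = 1 + t * (ν.real A - ν.real B) + t ^ 2 * ν.real (symmDiff A B) := by
          have h1 : Integrable (fun x => 1 + t * g x) ν :=
            (integrable_const 1).add (hIg.const_mul t)
          rw [integral_add h1 (hID.const_mul _), integral_add (integrable_const 1) (hIg.const_mul t),
            integral_const_mul,
            integral_const_mul, integral_sub hIA hIB, integral_indicator_one hA,
            integral_indicator_one hB, integral_indicator_one (hA.symmDiff hB)]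
          simp
      _ ≤ t * (ν.real A - ν.real B) + t ^ 2 * s + 1 := by
          have := mul_le_mul_of_nonneg_left hs (sq_nonneg t)
          linarith
      _ ≤ _ := Real.add_one_le_exp _
  refine (measureReal_sum_ge_le_pow hind hlaw hgm ht hint hb).trans_eq ?_
  rw [← Real.exp_add, ← Real.exp_nat_mul]
  congr 1
  ring

end Chernoff

/-! ### The standard normal CDF. -/

theorem stdNormalCDF_mono : Monotone stdNormalCDF := monotone_cdf (gaussianReal 0 1)

theorem stdNormalCDF_nonneg (x : ℝ) : 0 ≤ stdNormalCDF x := cdf_nonneg _ x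

theorem stdNormalCDF_le_one (x : ℝ) : stdNormalCDF x ≤ 1 := cdf_le_one _ x

theorem stdNormalCDF_sub_eq {x y : ℝ} (h : x ≤ y) :
    stdNormalCDF y - stdNormalCDF x = (gaussianReal 0 1).real (Set.Ioc x y) := by
  have hd : Set.Ioc x y = Set.Iic y \ Set.Iic x := by ext z; simp [and_comm]
  rw [stdNormalCDF, stdNormalCDF, cdf_eq_real, cdf_eq_real, hd,
    measureReal_sdiff (Set.Iic_subset_Iic.2 h) measurableSet_Iic]

theorem gaussianPDFReal_std_le_one (x : ℝ) : gaussianPDFReal 0 1 x ≤ 1 := by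
  rw [gaussianPDFReal]
  have h1 : (√(2 * Real.pi * (1 : NNReal)))⁻¹ ≤ 1 := by
    apply inv_le_one_of_one_le₀
    rw [Real.one_le_sqrt]
    have := Real.pi_gt_three
    simp
    linarith
  have h2 : Real.exp (-(x - 0) ^ 2 / (2 * (1 : NNReal))) ≤ 1 := by
    rw [Real.exp_le_one_iff]
    have := sq_nonneg (x - 0)
    exact div_nonpos_of_nonpos_of_nonneg (by linarith) (by positivity)
  exact mul_le_one₀ h1 (Real.exp_pos _).le h2

theorem abs_stdNormalCDF_sub_le (x y : ℝ) : |stdNormalCDF x - stdNormalCDF y| ≤ |x - y| := by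
  wlog h : x ≤ y generalizing x y
  · rw [abs_sub_comm, abs_sub_comm x]
    exact this y x (le_of_not_ge h)
  rw [abs_sub_comm, abs_sub_comm x, abs_of_nonneg (sub_nonneg.2 (stdNormalCDF_mono h)),
    abs_of_nonneg (sub_nonneg.2 h), stdNormalCDF_sub_eq h, measureReal_def,
    gaussianReal_apply_eq_integral 0 one_ne_zero]
  rw [ENNReal.toReal_ofReal (integral_nonneg fun _ => gaussianPDFReal_nonneg _ _ _)]
  calc _ ≤ ∫ _ in Set.Ioc x y, (1 : ℝ) :=
        integral_mono (integrable_gaussianPDFReal 0 1).integrableOn (integrable_const 1)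
          gaussianPDFReal_std_le_one
    _ = y - x := by simp [h]

theorem continuous_stdNormalCDF : Continuous stdNormalCDF :=
  (LipschitzWith.of_dist_le_mul (K := 1) fun x y => by
    simpa [Real.dist_eq] using abs_stdNormalCDF_sub_le x y).continuous

/-- Under the standard Gaussian law, `Φ` is (sub-)uniformly distributed. -/
theorem gaussianReal_stdNormalCDF_mem_Icc_le {a b : ℝ} (hab : a ≤ b) :
    (gaussianReal 0 1).real {x | stdNormalCDF x ∈ Set.Icc a b} ≤ b - a := by
  have hmeas : MeasurableSet {x | stdNormalCDF x ∈ Set.Icc a b} :=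
    continuous_stdNormalCDF.measurable measurableSet_Icc
  have key : gaussianReal 0 1 {x | stdNormalCDF x ∈ Set.Icc a b} ≤ ENNReal.ofReal (b - a) := by
    -- Inner regularity replaces inverting `Φ`: a compact subset attains its extrema, and `Φ` maps
    -- both into `[a, b]`.
    rw [hmeas.measure_eq_iSup_isCompact]
    refine iSup₂_le fun K hK => iSup_le fun hKc => ?_
    rcases K.eq_empty_or_nonempty with rfl | hne
    · simp
    have hx := hKc.sInf_mem hne
    have hy := hKc.sSup_mem hne
    have hsub : K ⊆ Set.Icc (sInf K) (sSup K) := fun z hz =>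
      ⟨csInf_le hKc.bddBelow hz, le_csSup hKc.bddAbove hz⟩
    have hle : sInf K ≤ sSup K := csInf_le hKc.bddBelow hy
    have := nullSingletonClass_gaussianReal (μ := 0) (v := 1) one_ne_zero
    calc gaussianReal 0 1 K ≤ gaussianReal 0 1 (Set.Icc (sInf K) (sSup K)) := measure_mono hsub
      _ = gaussianReal 0 1 (Set.Ioc (sInf K) (sSup K)) := (measure_congr Ioc_ae_eq_Icc).symm
      _ = ENNReal.ofReal (stdNormalCDF (sSup K) - stdNormalCDF (sInf K)) := by
          rw [stdNormalCDF_sub_eq hle, ofReal_measureReal]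
      _ ≤ _ := by
          apply ENNReal.ofReal_le_ofReal
          linarith [(hK hx).1, (hK hy).2]
  exact ENNReal.toReal_le_of_le_ofReal (sub_nonneg.2 hab) key

/-! ### Gaussian mass of halfspaces and exponential moments. -/

section StdGaussian

variable {E : Type*} [NormedAddCommGroup E] [InnerProductSpace ℝ E] [FiniteDimensional ℝ E]
  [MeasurableSpace E] [BorelSpace E]

/-- The marginal of the standard Gaussian in the direction of a unit vector. -/
theorem stdGaussian_map_inner {v : E} (hv : ‖v‖ = 1) :
    (stdGaussian E).map (fun x => inner ℝ v x) = gaussianReal 0 1 := by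
  have h := IsGaussian.map_eq_gaussianReal (μ := stdGaussian E) (innerSL ℝ v)
  rw [integral_strongDual_stdGaussian, variance_dual_stdGaussian, innerSL_apply_norm, hv] at h
  simpa using h

theorem integrable_inner_sq_stdGaussian (w : E) :
    Integrable (fun x => inner ℝ w x ^ 2) (stdGaussian E) := by
  have : MemLp (innerSL ℝ w) 2 (stdGaussian E) := IsGaussian.memLp_dual _ _ _ (by simp)
  exact this.integrable_sq

theorem integral_inner_sq_stdGaussian (w : E) :
    ∫ x, inner ℝ w x ^ 2 ∂(stdGaussian E) = ‖w‖ ^ 2 := by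
  have h := variance_dual_stdGaussian (E := E) (innerSL ℝ w)
  rw [variance_of_integral_eq_zero (by fun_prop) (integral_strongDual_stdGaussian _),
    innerSL_apply_norm] at h
  exact h

theorem stdGaussian_abs_inner_ge_le (w : E) {η : ℝ} (hη : 0 < η) :
    (stdGaussian E).real {x | η ≤ |inner ℝ w x|} ≤ ‖w‖ ^ 2 / η ^ 2 := by
  have h := mul_meas_ge_le_integral_of_nonneg (μ := stdGaussian E)
    (ae_of_all _ fun x : E => sq_nonneg (inner ℝ w x)) (integrable_inner_sq_stdGaussian w) (η ^ 2)
  rw [integral_inner_sq_stdGaussian] at h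
  rw [le_div_iff₀ (by positivity), mul_comm]
  refine le_trans (le_of_eq ?_) h
  congr 2
  ext x
  simp only [Set.mem_ofPred_eq]
  rw [← sq_abs (inner ℝ w x), sq_le_sq₀ hη.le (abs_nonneg _)]

/-- The halfspace with normal vector `v` and boundary at the Gaussian quantile of level `q`. -/
def quantileHalfspace (v : E) (q : ℝ) : Set E := {x | q ≤ stdNormalCDF (inner ℝ v x)}

theorem measurableSet_quantileHalfspace (v : E) (q : ℝ) :
    MeasurableSet (quantileHalfspace v q) :=
  measurableSet_le measurable_const
    (continuous_stdNormalCDF.measurable.comp (by fun_prop))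

theorem stdGaussian_cdf_inner_mem_Icc_le {v : E} (hv : ‖v‖ = 1) {a b : ℝ} (hab : a ≤ b) :
    (stdGaussian E).real {x | stdNormalCDF (inner ℝ v x) ∈ Set.Icc a b} ≤ b - a := by
  refine le_trans (le_of_eq ?_) (gaussianReal_stdNormalCDF_mem_Icc_le hab)
  rw [← stdGaussian_map_inner hv]
  exact (map_measureReal_apply (by fun_prop)
    (continuous_stdNormalCDF.measurable measurableSet_Icc)).symm

theorem stdGaussian_quantileHalfspace_le {v : E} (hv : ‖v‖ = 1) {q : ℝ} (hq : q ≤ 1) :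
    (stdGaussian E).real (quantileHalfspace v q) ≤ 1 - q :=
  le_trans (measureReal_mono fun _ hx => Set.mem_ofPred.2 ⟨hx, stdNormalCDF_le_one _⟩)
    (stdGaussian_cdf_inner_mem_Icc_le hv hq)

/-- Since `Φ` is 1-Lipschitz, a point of the difference either has `Φ⟨v, x⟩` within `δ + κ` of `q`,
a strip of mass at most its length in levels, or satisfies `|⟨v - v', x⟩| ≥ κ`, which Chebyshev
controls. -/
theorem stdGaussian_symmDiff_quantileHalfspace_le {v v' : E} (hv : ‖v‖ = 1) {q q' δ κ : ℝ}
    (hδ : ‖v - v'‖ ≤ δ) (hq : |q - q'| ≤ δ) (hκ : 0 < κ) :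
    (stdGaussian E).real (symmDiff (quantileHalfspace v q) (quantileHalfspace v' q')) ≤
      2 * (δ + κ) + δ ^ 2 / κ ^ 2 := by
  have hδ0 : 0 ≤ δ := (norm_nonneg _).trans hδ
  have hsub : symmDiff (quantileHalfspace v q) (quantileHalfspace v' q') ⊆
      {x | stdNormalCDF (inner ℝ v x) ∈ Set.Icc (q - (δ + κ)) (q + (δ + κ))} ∪
        {x | κ ≤ |inner ℝ (v - v') x|} := by
    intro x hx
    by_contra hcon
    simp only [Set.mem_union, Set.mem_ofPred_eq, Set.mem_Icc, not_or, not_and_or, not_le] at hcon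
    obtain ⟨h1, h2⟩ := hcon
    rw [inner_sub_left] at h2
    have h3 := abs_lt.1 ((abs_stdNormalCDF_sub_le _ _).trans_lt h2)
    have h4 := abs_le.1 hq
    rcases hx with ⟨ha, hb⟩ | ⟨ha, hb⟩
    all_goals
      simp only [quantileHalfspace, Set.mem_ofPred_eq, not_le] at ha hb
      rcases h1 with h1 | h1 <;> linarith
  refine (measureReal_mono hsub).trans ((measureReal_union_le _ _).trans (add_le_add ?_ ?_))
  · refine (stdGaussian_cdf_inner_mem_Icc_le hv (by linarith)).trans (le_of_eq (by ring))
  · refine (stdGaussian_abs_inner_ge_le _ hκ).trans ?_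
    gcongr

theorem integrable_exp_abs_inner_stdGaussian {v : E} (hv : ‖v‖ = 1) :
    Integrable (fun x => Real.exp (1 * |inner ℝ v x|)) (stdGaussian E) ∧
      ∫ x, Real.exp (1 * |inner ℝ v x|) ∂(stdGaussian E) ≤ Real.exp 2 := by
  have hI : ∀ t : ℝ, Integrable (fun x => Real.exp (t * inner ℝ v x)) (stdGaussian E) := by
    intro t
    have h := integrable_exp_mul_gaussianReal (μ := 0) (v := 1) t
    rw [← stdGaussian_map_inner hv] at h
    exact h.comp_aemeasurable (by fun_prop)
  have hv' : ∀ t : ℝ, ∫ x, Real.exp (t * inner ℝ v x) ∂(stdGaussian E) = Real.exp (t ^ 2 / 2) := by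
    intro t
    have h := mgf_gaussianReal (stdGaussian_map_inner hv) t
    simpa [mgf] using h
  have hle : ∀ x : E, Real.exp (1 * |inner ℝ v x|) ≤
      Real.exp (1 * inner ℝ v x) + Real.exp (-1 * inner ℝ v x) := fun x => by
    rcases abs_cases (inner ℝ v x) with ⟨h, _⟩ | ⟨h, _⟩ <;> rw [h]
    · linarith [Real.exp_pos (-1 * inner ℝ v x)]
    · rw [one_mul, ← neg_one_mul]
      linarith [Real.exp_pos (1 * inner ℝ v x)]
  have hsum := (hI 1).add (hI (-1))
  have hint : Integrable (fun x => Real.exp (1 * |inner ℝ v x|)) (stdGaussian E) := by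
    refine hsum.mono' (by fun_prop) (ae_of_all _ fun x => ?_)
    rw [Real.norm_eq_abs, Real.abs_exp]
    exact hle x
  refine ⟨hint, (integral_mono hint hsum hle).trans ?_⟩
  simp only [Pi.add_apply]
  rw [integral_add (hI 1) (hI (-1)), hv', hv']
  have h1 : Real.exp 2 = Real.exp (1 / 2) * Real.exp (3 / 2) := by
    rw [← Real.exp_add]; norm_num
  have h2 : (2 : ℝ) ≤ Real.exp (3 / 2) := by
    have := Real.add_one_le_exp (3 / 2 : ℝ)
    linarith
  norm_num
  rw [h1]
  nlinarith [Real.exp_pos (1 / 2 : ℝ)]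

end StdGaussian

/-! ### Union bounds over the nets and the links of the chain. -/

theorem measureReal_biUnion_finset_le_card_mul {Ω ι : Type*} [MeasurableSpace Ω] {P : Measure Ω}
    [IsFiniteMeasure P] (I : Finset ι) (B : ι → Set Ω) {b : ℝ} (h : ∀ i ∈ I, P.real (B i) ≤ b) :
    P.real (⋃ i ∈ I, B i) ≤ I.card * b := by
  refine (measureReal_biUnion_finset_le I B).trans ((Finset.sum_le_sum h).trans_eq ?_)
  rw [Finset.sum_const, nsmul_eq_mul]

section Chaining

variable {E : Type*} [NormedAddCommGroup E] [InnerProductSpace ℝ E] [FiniteDimensional ℝ E]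

/-- A sublinear bound on a net of the sphere extends to the whole space. -/
theorem sum_abs_inner_le_of_net {ι : Type*} [Fintype ι] (z : ι → E) {T : Finset E} {b : ℝ}
    (hT : ∀ v : E, ‖v‖ = 1 → ∃ w ∈ T, ‖v - w‖ ≤ 1 / 2)
    (hb : ∀ w ∈ T, ∑ i, |inner ℝ w (z i)| ≤ b) (w : E) :
    ∑ i, |inner ℝ w (z i)| ≤ 2 * b * ‖w‖ := by
  set N : E → ℝ := fun w => ∑ i, |inner ℝ w (z i)| with hN
  have hsmul : ∀ (a : ℝ) (w : E), N (a • w) = |a| * N w := fun a w => by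
    simp only [hN, real_inner_smul_left, abs_mul, Finset.mul_sum]
  have hadd : ∀ w w' : E, N w ≤ N (w - w') + N w' := fun w w' => by
    simp only [hN, ← Finset.sum_add_distrib]
    refine Finset.sum_le_sum fun i _ => ?_
    rw [inner_sub_left]
    linarith [abs_sub_abs_le_abs_sub (inner ℝ w (z i)) (inner ℝ w' (z i))]
  have hscale : ∀ w : E, w ≠ 0 → N w = ‖w‖ * N (‖w‖⁻¹ • w) := fun w hw => by
    rw [hsmul, abs_inv, abs_norm, mul_inv_cancel_left₀ (norm_ne_zero_iff.2 hw)]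
  have hcont : Continuous N := by fun_prop
  have hzero : N 0 = 0 := by simp [hN]
  rcases eq_or_ne w 0 with rfl | hw
  · simp
  have hunit : ∀ w : E, w ≠ 0 → ‖w‖⁻¹ • w ∈ Metric.sphere (0 : E) 1 := fun w hw => by
    rw [mem_sphere_zero_iff_norm, norm_smul, norm_inv, norm_norm,
      inv_mul_cancel₀ (norm_ne_zero_iff.2 hw)]
  obtain ⟨x, hx, hmax⟩ := (isCompact_sphere (0 : E) 1).exists_isMaxOn ⟨_, hunit w hw⟩
    hcont.continuousOn
  have hle : ∀ w : E, N w ≤ ‖w‖ * N x := fun w => by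
    rcases eq_or_ne w 0 with rfl | hw
    · simp [hzero]
    · rw [hscale w hw]
      exact mul_le_mul_of_nonneg_left (hmax (hunit w hw)) (norm_nonneg _)
  have hx0 : 0 ≤ N x := Finset.sum_nonneg fun _ _ => abs_nonneg _
  -- At a maximiser `x` on the sphere, `N x ≤ N x' + N (x - x') ≤ b + N x / 2`, hence `N x ≤ 2b`.
  obtain ⟨x', hx'T, hx'⟩ := hT x (mem_sphere_zero_iff_norm.1 hx)
  have h1 := hadd x x'
  have h2 := hle (x - x')
  have h3 := hb x' hx'T
  have h4 := mul_le_mul_of_nonneg_right hx' hx0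
  have h5 : N x ≤ 2 * b := by linarith
  have := mul_le_mul_of_nonneg_left h5 (norm_nonneg w)
  linarith [hle w]

/-- A net for pairs (unit direction, level in `[0, 1]`), rounding the levels down. -/
theorem exists_direction_level_net (hd : 1 ≤ Module.finrank ℝ E) (k : ℕ) :
    ∃ N : Finset (E × ℝ), (∀ θ ∈ N, ‖θ.1‖ = 1 ∧ θ.2 ≤ 1) ∧
      (∀ v : E, ‖v‖ = 1 → ∀ q : ℝ, 0 ≤ q → q ≤ 1 →
        ∃ θ ∈ N, ‖v - θ.1‖ ≤ (1 / 64) ^ k ∧ θ.2 ≤ q ∧ q - θ.2 ≤ (1 / 64) ^ k) ∧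
      (N.card : ℝ) ≤ (6 * 4096 ^ k) ^ Module.finrank ℝ E := by
  classical
  have hpos : (0 : ℝ) < (1 / 64) ^ k := by positivity
  have hmul : (1 / 64 : ℝ) ^ k * 64 ^ k = 1 := by rw [← mul_pow]; norm_num
  obtain ⟨T, hT1, hT, hTc⟩ := exists_sphere_net E hpos
  let G : Finset ℝ := (Finset.range (64 ^ k + 1)).image fun j : ℕ => (j : ℝ) * (1 / 64) ^ k
  refine ⟨T ×ˢ G, ?_, ?_, ?_⟩
  · intro θ hθ
    obtain ⟨h1, h2⟩ := Finset.mem_product.1 hθ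
    refine ⟨hT1 _ h1, ?_⟩
    obtain ⟨j, hj, hjθ⟩ := Finset.mem_image.1 h2
    have hj' : (j : ℝ) ≤ 64 ^ k := by
      exact_mod_cast Nat.lt_succ_iff.1 (Finset.mem_range.1 hj)
    rw [← hjθ]
    nlinarith
  · intro v hv q hq0 hq1
    obtain ⟨w, hw, hvw⟩ := hT v hv
    have hfl := Nat.floor_le (a := q * 64 ^ k) (by positivity)
    have hfl' := Nat.lt_floor_add_one (q * 64 ^ k)
    have hq : q * 64 ^ k * (1 / 64) ^ k = q := by rw [mul_assoc, mul_comm (64 ^ k), hmul, mul_one]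
    refine ⟨(w, (⌊q * 64 ^ k⌋₊ : ℝ) * (1 / 64) ^ k), Finset.mem_product.2 ⟨hw, ?_⟩, hvw, ?_, ?_⟩
    · refine Finset.mem_image_of_mem _ (Finset.mem_range.2 (Nat.lt_succ_of_le ?_))
      refine Nat.floor_le_of_le ?_
      push_cast
      exact mul_le_of_le_one_left (by positivity) hq1
    · have := mul_le_mul_of_nonneg_right hfl hpos.le
      rwa [hq] at this
    · have := mul_le_mul_of_nonneg_right hfl'.le hpos.le
      rw [hq] at this
      simp only
      linarith
  · have h64 : (1 : ℝ) ≤ 64 ^ k := one_le_pow₀ (by norm_num)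
    have hG : (G.card : ℝ) ≤ 2 * 64 ^ k := by
      have : G.card ≤ 64 ^ k + 1 := Finset.card_image_le.trans_eq (Finset.card_range _)
      have : (G.card : ℝ) ≤ 64 ^ k + 1 := by exact_mod_cast this
      linarith
    -- Weakened to a `d`-th power, possible as `d ≥ 1`, so that it merges with the bound for `T`.
    have hG' : (G.card : ℝ) ≤ (2 * 64 ^ k) ^ Module.finrank ℝ E :=
      hG.trans (le_self_pow₀ (by linarith) (by omega))
    have hT' : (T.card : ℝ) ≤ (3 * 64 ^ k) ^ Module.finrank ℝ E := by
      refine hTc.trans (pow_le_pow_left₀ (by positivity) ?_ _)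
      rw [div_eq_mul_inv, eq_comm.1 (eq_inv_of_mul_eq_one_right hmul)]
      linarith
    rw [Finset.card_product, Nat.cast_mul]
    calc _ ≤ (3 * 64 ^ k : ℝ) ^ Module.finrank ℝ E * (2 * 64 ^ k) ^ Module.finrank ℝ E := by gcongr
      _ = _ := by
        rw [← mul_pow]
        congr 1
        rw [show (4096 : ℝ) = 64 * 64 by norm_num, mul_pow]
        ring

/-- The number of points of the family `z` in the halfspace with parameters `θ`. -/
noncomputable def quantileCount {ι : Type*} [Fintype ι] (z : ι → E) (θ : E × ℝ) : ℝ :=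
  ∑ i, (quantileHalfspace θ.1 θ.2).indicator 1 (z i)

variable [MeasurableSpace E] [BorelSpace E]
variable {Ω : Type*} [MeasurableSpace Ω] {P : Measure Ω}
  [IsProbabilityMeasure P] {m : ℕ} {Z : Fin m → Ω → E}

/-- The Gaussian measure of the halfspace with parameters `θ`. -/
noncomputable def quantileMass (θ : E × ℝ) : ℝ := (stdGaussian E).real (quantileHalfspace θ.1 θ.2)

/-- A `1/2`-net has at most `5^d ≤ e^{2d}` points. At each, Chernoff with `t = 1` and threshold `4m`
gives `e^{2m - 4m}`; passing from the net to all `w` doubles `4` to `8`. -/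
theorem measureReal_exists_sum_abs_inner_gt_le (hind : iIndepFun Z P)
    (hlaw : ∀ i, HasLaw (Z i) (stdGaussian E) P) :
    P.real {ω | ∃ w : E, 8 * m * ‖w‖ < ∑ i, |inner ℝ w (Z i ω)|} ≤
      Real.exp (2 * Module.finrank ℝ E - 2 * m) := by
  obtain ⟨T, hT1, hT, hTc⟩ := exists_sphere_net E (δ := 1 / 2) (by norm_num)
  have hsub : {ω | ∃ w : E, 8 * m * ‖w‖ < ∑ i, |inner ℝ w (Z i ω)|} ⊆
      ⋃ w ∈ T, {ω | m * 4 ≤ ∑ i, |inner ℝ w (Z i ω)|} := by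
    rintro ω ⟨w, hw⟩
    by_contra hcon
    simp only [Set.mem_iUnion, Set.mem_ofPred_eq, exists_prop, not_exists, not_and, not_le] at hcon
    have := sum_abs_inner_le_of_net (fun i => Z i ω) hT (fun w hw => (hcon w hw).le) w
    linarith
  have h5 : (5 : ℝ) ≤ Real.exp 2 := by
    have := Real.quadratic_le_exp_of_nonneg (x := 2) (by norm_num)
    linarith
  have hone : ∀ w ∈ T, P.real {ω | m * 4 ≤ ∑ i, |inner ℝ w (Z i ω)|} ≤ Real.exp (-2 * m) := by
    intro w hw
    obtain ⟨h1, h2⟩ := integrable_exp_abs_inner_stdGaussian (hT1 w hw)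
    have := measureReal_sum_ge_le_pow hind hlaw (g := fun x => |inner ℝ w x|) (by fun_prop)
      zero_le_one h1 h2 (u := 4)
    refine this.trans_eq ?_
    rw [← Real.exp_add, ← Real.exp_nat_mul]
    congr 1
    ring
  refine (measureReal_mono hsub (measure_ne_top _ _)).trans
    ((measureReal_biUnion_finset_le_card_mul T _ hone).trans ?_)
  have hT5 : (T.card : ℝ) ≤ Real.exp (2 * Module.finrank ℝ E) := by
    rw [mul_comm, Real.exp_nat_mul]
    refine hTc.trans (pow_le_pow_left₀ (by norm_num) ?_ _)
    norm_num
    exact h5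
  calc _ ≤ Real.exp (2 * Module.finrank ℝ E) * Real.exp (-2 * m) := by gcongr
    _ = _ := by
      rw [← Real.exp_add]
      ring_nf

/-- Deviation bound for one link of the chain. -/
theorem measureReal_exists_link_ge_le (hind : iIndepFun Z P)
    (hlaw : ∀ i, HasLaw (Z i) (stdGaussian E) P) {N N' : Finset (E × ℝ)}
    (hN' : ∀ θ ∈ N', ‖θ.1‖ = 1) {α y : ℝ} (hα : 0 < α) (hy : 0 < y) (hy1 : y ≤ 1)
    (hαy : α / 288 ≤ y ^ 3) :
    P.real {ω | ∃ θ ∈ N, ∃ θ' ∈ N', ‖θ'.1 - θ.1‖ ≤ 2 * y ^ 6 ∧ |θ'.2 - θ.2| ≤ 2 * y ^ 6 ∧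
      m * (quantileMass θ' - quantileMass θ + α * y / 16) ≤
        quantileCount (fun i => Z i ω) θ' - quantileCount (fun i => Z i ω) θ} ≤
      N.card * N'.card * Real.exp (-(m * α ^ 2 / (9216 * y ^ 2))) := by
  classical
  set I := (N ×ˢ N').filter fun p : (E × ℝ) × (E × ℝ) =>
    ‖p.2.1 - p.1.1‖ ≤ 2 * y ^ 6 ∧ |p.2.2 - p.1.2| ≤ 2 * y ^ 6
  have hsub : {ω | ∃ θ ∈ N, ∃ θ' ∈ N', ‖θ'.1 - θ.1‖ ≤ 2 * y ^ 6 ∧ |θ'.2 - θ.2| ≤ 2 * y ^ 6 ∧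
      m * (quantileMass θ' - quantileMass θ + α * y / 16) ≤
        quantileCount (fun i => Z i ω) θ' - quantileCount (fun i => Z i ω) θ} ⊆
      ⋃ p ∈ I, {ω | m * (quantileMass p.2 - quantileMass p.1 + α * y / 16) ≤
        quantileCount (fun i => Z i ω) p.2 - quantileCount (fun i => Z i ω) p.1} := by
    rintro ω ⟨θ, hθ, θ', hθ', h1, h2, h3⟩
    exact Set.mem_biUnion (x := (θ, θ'))
      (Finset.mem_filter.2 ⟨Finset.mem_product.2 ⟨hθ, hθ'⟩, h1, h2⟩) h3
  have hone : ∀ p ∈ I, P.real {ω | m * (quantileMass p.2 - quantileMass p.1 + α * y / 16) ≤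
        quantileCount (fun i => Z i ω) p.2 - quantileCount (fun i => Z i ω) p.1} ≤
        Real.exp (-(m * α ^ 2 / (9216 * y ^ 2))) := by
    intro p hp
    obtain ⟨hp1, hp2, hp3⟩ := Finset.mem_filter.1 hp
    have hs : (stdGaussian E).real (symmDiff (quantileHalfspace p.2.1 p.2.2)
        (quantileHalfspace p.1.1 p.1.2)) ≤ 9 * y ^ 4 := by
      -- With `δ = 2y^6`, the choice `κ = 2y^4` makes both the strip term and the Chebyshev term of
      -- order `y^4`.
      refine (stdGaussian_symmDiff_quantileHalfspace_le (hN' _ (Finset.mem_product.1 hp1).2)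
        hp2 hp3 (κ := 2 * y ^ 4) (by positivity)).trans ?_
      have h1 : (2 * y ^ 6) ^ 2 / (2 * y ^ 4) ^ 2 = y ^ 4 := by field_simp
      have h2 : y ^ 6 ≤ y ^ 4 := pow_le_pow_of_le_one hy.le hy1 (by norm_num)
      rw [h1]
      linarith
    have ht1 : α / (288 * y ^ 3) ≤ 1 := by
      rw [div_le_one (by positivity)]
      linarith
    -- `t = u/(2s)` minimises `t²s - tu` for `s = 9y^4`, `u = αy/16`; `hαy` is exactly the
    -- constraint `t ≤ 1`.
    have h := measureReal_count_sub_ge_le hind hlaw (measurableSet_quantileHalfspace p.2.1 p.2.2)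
      (measurableSet_quantileHalfspace p.1.1 p.1.2) hs (t := α / (288 * y ^ 3))
      (by positivity) ht1 (u := α * y / 16)
    simp only [Finset.sum_sub_distrib] at h
    refine h.trans_eq ?_
    congr 1
    field_simp
    ring
  refine (measureReal_mono hsub (measure_ne_top _ _)).trans
    ((measureReal_biUnion_finset_le_card_mul I _ hone).trans ?_)
  gcongr
  exact_mod_cast (Finset.card_filter_le _ _).trans (Finset.card_product _ _).le

/-- Deviation bound for the starting points of the chain. -/
theorem measureReal_exists_count_ge_le (hind : iIndepFun Z P)
    (hlaw : ∀ i, HasLaw (Z i) (stdGaussian E) P) (N : Finset (E × ℝ)) {α : ℝ} (hα : 0 < α)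
    (hα1 : α ≤ 1) :
    P.real {ω | ∃ θ ∈ N, m * (quantileMass θ + α / 16) ≤ quantileCount (fun i => Z i ω) θ} ≤
      N.card * Real.exp (-(m * α ^ 2 / 1024)) := by
  have hsub : {ω | ∃ θ ∈ N, m * (quantileMass θ + α / 16) ≤ quantileCount (fun i => Z i ω) θ} ⊆
      ⋃ θ ∈ N, {ω | m * (quantileMass θ + α / 16) ≤ quantileCount (fun i => Z i ω) θ} := by
    rintro ω ⟨θ, hθ, h⟩
    exact Set.mem_biUnion (x := θ) hθ h
  refine (measureReal_mono hsub (measure_ne_top _ _)).trans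
    (measureReal_biUnion_finset_le_card_mul N _ fun θ _ => ?_)
  -- Compared with the empty set: `s = 1` and again `t = u/2`.
  have h := measureReal_count_sub_ge_le hind hlaw (measurableSet_quantileHalfspace θ.1 θ.2)
    MeasurableSet.empty (s := 1) measureReal_le_one (t := α / 32)
    (by positivity) (by linarith) (u := α / 16)
  simp only [measureReal_empty, sub_zero, Set.indicator_empty] at h
  refine h.trans_eq ?_
  congr 1
  ring

end Chaining

/-! ### Chaining and uniform convergence over halfspaces. -/

section Uniform

variable {E : Type*} [NormedAddCommGroup E] [InnerProductSpace ℝ E]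

/-- A point counted on the left only has `|⟨v - w, z_i⟩| ≥ a`, so Markov's inequality applies term
by term. If `r ≤ 0`, every point is counted on the right. -/
theorem quantileCount_le_add {ι : Type*} [Fintype ι] (z : ι → E) {v w : E} {q r a : ℝ}
    (ha : 0 < a) (hr : r ≤ max (q - a) 0) :
    quantileCount z (v, q) ≤ quantileCount z (w, r) + (∑ i, |inner ℝ (v - w) (z i)|) / a := by
  unfold quantileCount
  rw [Finset.sum_div, ← Finset.sum_add_distrib]
  refine Finset.sum_le_sum fun i _ => ?_
  have h0 : 0 ≤ |inner ℝ (v - w) (z i)| / a := by positivity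
  by_cases h1 : z i ∈ quantileHalfspace v q
  · by_cases h2 : z i ∈ quantileHalfspace w r
    · simpa [h1, h2] using h0
    · have h3 : a ≤ |inner ℝ (v - w) (z i)| := by
        simp only [quantileHalfspace, Set.mem_ofPred_eq, not_le] at h1 h2
        have h4 := stdNormalCDF_nonneg (inner ℝ w (z i))
        have h5 := (le_abs_self _).trans
          (abs_stdNormalCDF_sub_le (inner ℝ v (z i)) (inner ℝ w (z i)))
        rw [inner_sub_left]
        rcases max_cases (q - a) 0 with ⟨h, _⟩ | ⟨h, _⟩ <;> rw [h] at hr <;> linarith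
      simpa [h1, h2] using (one_le_div ha).2 h3
  · have h2 : (0 : ℝ) ≤ (quantileHalfspace w r).indicator 1 (z i) :=
      Set.indicator_nonneg (fun _ _ => zero_le_one) _
    simp only [h1, not_false_eq_true, Set.indicator_of_notMem]
    positivity

variable [FiniteDimensional ℝ E] [MeasurableSpace E] [BorelSpace E]

/-- Deterministic chaining: control of the starting points, the links and the linear remainder
yields control of all halfspaces. -/
theorem quantileCount_le_of_chain {m : ℕ} {z : Fin m → E} {α : ℝ} (hα : 0 < α) (hα1 : α < 1)
    {N : ℕ → Finset (E × ℝ)} (hN1 : ∀ k, ∀ θ ∈ N k, ‖θ.1‖ = 1 ∧ θ.2 ≤ 1)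
    (hN : ∀ k, ∀ v : E, ‖v‖ = 1 → ∀ q : ℝ, 0 ≤ q → q ≤ 1 →
        ∃ θ ∈ N k, ‖v - θ.1‖ ≤ (1 / 64) ^ k ∧ θ.2 ≤ q ∧ q - θ.2 ≤ (1 / 64) ^ k)
    {K : ℕ} (hK : (1 / 8 : ℝ) ^ K ≤ α / 288)
    (h0 : ∀ θ ∈ N 0, quantileCount z θ ≤ m * (quantileMass θ + α / 16))
    (hlink : ∀ k < K, ∀ θ ∈ N k, ∀ θ' ∈ N (k + 1), ‖θ'.1 - θ.1‖ ≤ 2 * ((1 / 2) ^ k) ^ 6 →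
      |θ'.2 - θ.2| ≤ 2 * ((1 / 2) ^ k) ^ 6 → quantileCount z θ' - quantileCount z θ ≤
        m * (quantileMass θ' - quantileMass θ + α * (1 / 2) ^ k / 16))
    (hlin : ∀ w : E, ∑ i, |inner ℝ w (z i)| ≤ 8 * m * ‖w‖)
    {v : E} (hv : ‖v‖ = 1) {q : ℝ} (hq1 : q ≤ 1) :
    quantileCount z (v, q) ≤ m * (1 - q + α / 2) := by
  -- Lowering the level by `α/16` leaves the margin needed for the final Markov step; clipping at
  -- `0` keeps it in the range of the nets.
  set q' := max (q - α / 16) 0 with hq'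
  have hq'0 : 0 ≤ q' := le_max_right _ _
  have hq'1 : q' ≤ 1 := max_le (by linarith) zero_le_one
  have hm : (0 : ℝ) ≤ m := Nat.cast_nonneg m
  choose θ hθN hθv hθq hθq' using fun k => hN k v hv q' hq'0 hq'1
  have hpow : ∀ k : ℕ, ((1 / 2 : ℝ) ^ k) ^ 6 = (1 / 64) ^ k := fun k => by
    rw [← pow_mul, mul_comm, pow_mul]; norm_num
  have hdec : ∀ k : ℕ, (1 / 64 : ℝ) ^ (k + 1) ≤ (1 / 64) ^ k := fun k =>
    pow_le_pow_of_le_one (by norm_num) (by norm_num) (Nat.le_succ k)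
  have chain : ∀ k ≤ K, quantileCount z (θ k) ≤
      m * (quantileMass (θ k) + α / 16 + α / 8 * (1 - (1 / 2) ^ k)) := by
    intro k
    induction k with
    | zero => intro _; simpa using h0 _ (hθN 0)
    | succ k ih =>
      intro hk
      have h1 := ih (by omega)
      have h2 := hlink k (by omega) _ (hθN k) _ (hθN (k + 1)) (by
        rw [hpow, show (θ (k + 1)).1 - (θ k).1 = (v - (θ k).1) - (v - (θ (k + 1)).1) by abel]
        linarith [norm_sub_le (v - (θ k).1) (v - (θ (k + 1)).1), hθv k, hθv (k + 1), hdec k]) (by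
        rw [hpow, abs_le]
        constructor <;> linarith [hθq k, hθq (k + 1), hθq' k, hθq' (k + 1), hdec k,
          pow_nonneg (by norm_num : (0 : ℝ) ≤ 1 / 64) k])
      have h3 : m * (quantileMass (θ (k + 1)) + α / 16 + α / 8 * (1 - (1 / 2) ^ (k + 1))) =
        m * (quantileMass (θ k) + α / 16 + α / 8 * (1 - (1 / 2) ^ k)) +
        m * (quantileMass (θ (k + 1)) - quantileMass (θ k) + α * (1 / 2) ^ k / 16) := by
        rw [pow_succ]; ring
      linarith
  have h64 : (1 / 64 : ℝ) ^ K ≤ α ^ 2 / 82944 := by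
    have h : (1 / 64 : ℝ) ^ K = ((1 / 8) ^ K) ^ 2 := by
      rw [← pow_mul, mul_comm, pow_mul]; norm_num
    rw [h]
    refine (pow_le_pow_left₀ (by positivity) hK 2).trans_eq (by ring)
  have hα2 : α ^ 2 ≤ α := by nlinarith
  have h1 := chain K le_rfl
  have h2 : quantileMass (θ K) ≤ 1 - (θ K).2 :=
    stdGaussian_quantileHalfspace_le (hN1 K _ (hθN K)).1 (hN1 K _ (hθN K)).2
  have h3 : q - α / 16 ≤ q' := le_max_left _ _
  have h4 : (0 : ℝ) ≤ (1 / 2) ^ K := by positivity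
  have h5 := quantileCount_le_add z (v := v) (w := (θ K).1) (r := (θ K).2)
    (by positivity : 0 < α / 16) (hθq K)
  have h6 : (∑ i, |inner ℝ (v - (θ K).1) (z i)|) / (α / 16) ≤ m * (α / 8) := by
    rw [div_le_iff₀ (by positivity)]
    refine (hlin _).trans ?_
    have h7 : 8 * m * ‖v - (θ K).1‖ ≤ 8 * m * (α ^ 2 / 82944) :=
      mul_le_mul_of_nonneg_left ((hθv K).trans h64) (by positivity)
    have h8 : 0 ≤ m * α ^ 2 := by positivity
    linarith
  -- Error budget: `α/16` from lowering the level, `α/16` from the start, at most `α/8` from the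
  -- links, and a rounding error `64^{-K}`. With the remainder `α/8` in `h6` the total is at most
  -- `α/2`.
  have h7 : quantileMass (θ K) + α / 16 + α / 8 * (1 - (1 / 2) ^ K) ≤ 1 - q + α * (3 / 8) := by
    have h8 : 0 ≤ α / 8 * (1 / 2) ^ K := by positivity
    linarith [hθq' K]
  have h8 := mul_le_mul_of_nonneg_left h7 hm
  have h9 : quantileCount z (v, q) ≤ quantileCount z (θ K) +
    (∑ i, |inner ℝ (v - (θ K).1) (z i)|) / (α / 16) := h5
  linarith

variable {Ω : Type*} [MeasurableSpace Ω] {P : Measure Ω}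
  [IsProbabilityMeasure P] {m : ℕ} {Z : Fin m → Ω → E}

/-- Uniform convergence over halfspaces for a standard Gaussian sample, at the rate without
logarithmic loss in the accuracy. -/
theorem exists_event_quantileCount_le (hd : 1 ≤ Module.finrank ℝ E) (hind : iIndepFun Z P)
    (hlaw : ∀ i, HasLaw (Z i) (stdGaussian E) P) {α γ : ℝ} (hα : 0 < α) (hα1 : α < 1)
    (hγ : 0 < γ) (hγ1 : γ < 1)
    (hm : 184320 * ((Module.finrank ℝ E + Real.log (1 / γ)) / α ^ 2) ≤ m) :
    ∃ G : Set Ω, MeasurableSet G ∧ 1 - γ ≤ P.real G ∧ ∀ ω ∈ G, ∀ v : E, ‖v‖ = 1 →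
      ∀ q : ℝ, q ≤ 1 → quantileCount (fun i => Z i ω) (v, q) ≤ m * (1 - q + α / 2) := by
  set D : ℝ := (Module.finrank ℝ E : ℝ) with hD
  have hD1 : 1 ≤ D := by rw [hD]; exact_mod_cast hd
  have hlogγ : 0 < Real.log (1 / γ) := Real.log_pos (by rw [one_div]; exact (one_lt_inv₀ hγ).2 hγ1)
  have hγexp : Real.exp (-Real.log (1 / γ)) = γ := by
    rw [one_div, Real.log_inv, neg_neg, Real.exp_log hγ]
  set l := Real.log (1 / γ) with hl
  have hmα : 184320 * (D + l) ≤ m * α ^ 2 := by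
    rwa [← mul_div_assoc, div_le_iff₀ (by positivity)] at hm
  choose N hN1 hN hNc using fun k => exists_direction_level_net (E := E) hd k
  have hex : ∃ K : ℕ, (1 / 8 : ℝ) ^ K ≤ α / 288 := by
    obtain ⟨K, hK⟩ := exists_pow_lt_of_lt_one (by positivity : 0 < α / 288)
      (by norm_num : (1 / 8 : ℝ) < 1)
    exact ⟨K, hK.le⟩
  classical
  -- Minimality of `K` gives `α/288 ≤ 8^{-k}` for all `k < K`, the condition for the link bound with
  -- `y = 2^{-k}`.
  set K := Nat.find hex
  have hK : (1 / 8 : ℝ) ^ K ≤ α / 288 := Nat.find_spec hex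
  have hKlt : ∀ k < K, α / 288 ≤ (1 / 8 : ℝ) ^ k := fun k hk => (not_le.1 (Nat.find_min hex hk)).le
  set B0 : Set Ω := {ω | ∃ θ ∈ N 0,
    m * (quantileMass θ + α / 16) ≤ quantileCount (fun i => Z i ω) θ}
  set B1 : ℕ → Set Ω := fun k => {ω | ∃ θ ∈ N k, ∃ θ' ∈ N (k + 1),
    ‖θ'.1 - θ.1‖ ≤ 2 * ((1 / 2) ^ k) ^ 6 ∧ |θ'.2 - θ.2| ≤ 2 * ((1 / 2) ^ k) ^ 6 ∧
      m * (quantileMass θ' - quantileMass θ + α * (1 / 2) ^ k / 16) ≤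
        quantileCount (fun i => Z i ω) θ' - quantileCount (fun i => Z i ω) θ}
  set B2 : Set Ω := {ω | ∃ w : E, 8 * m * ‖w‖ < ∑ i, |inner ℝ w (Z i ω)|}
  have e1 : (2.7 : ℝ) ≤ Real.exp 1 := by linarith [Real.exp_one_gt_d9]
  have e2 : (6 : ℝ) ≤ Real.exp 2 := by
    have : Real.exp 2 = Real.exp 1 * Real.exp 1 := by rw [← Real.exp_add]; norm_num
    nlinarith
  have e3 : Real.exp (-3) ≤ 1 / 8 := by
    have : Real.exp 3 = Real.exp 2 * Real.exp 1 := by rw [← Real.exp_add]; norm_num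
    rw [Real.exp_neg, one_div]
    exact inv_anti₀ (by norm_num) (by nlinarith)
  have hexp : ∀ x : ℝ, x ≤ -3 - l → Real.exp x ≤ γ / 8 := fun x hx => by
    have : Real.exp (-3 - l) = Real.exp (-3) * γ := by
      rw [sub_eq_add_neg, Real.exp_add, hγexp]
    have h := Real.exp_le_exp.2 hx
    nlinarith
  have hP0 : P.real B0 ≤ γ / 8 := by
    refine (measureReal_exists_count_ge_le hind hlaw (N 0) hα hα1.le).trans ?_
    have hc : ((N 0).card : ℝ) ≤ Real.exp (2 * D) := by
      rw [mul_comm, hD, Real.exp_nat_mul]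
      refine (hNc 0).trans (pow_le_pow_left₀ (by positivity) ?_ _)
      simpa using e2
    calc _ ≤ Real.exp (2 * D) * Real.exp (-(m * α ^ 2 / 1024)) := by gcongr
      _ = Real.exp (2 * D - m * α ^ 2 / 1024) := by rw [← Real.exp_add]; ring_nf
      _ ≤ _ := hexp _ (by linarith)
  have hP2 : P.real B2 ≤ γ / 8 := by
    refine (measureReal_exists_sum_abs_inner_gt_le hind hlaw).trans (hexp _ ?_)
    have : m * α ^ 2 ≤ m := mul_le_of_le_one_right (Nat.cast_nonneg m) (by nlinarith)
    linarith
  have hP1 : ∀ k < K, P.real (B1 k) ≤ γ * (1 / 8) ^ (k + 1) := by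
    intro k hk
    have h8 : ((1 / 2 : ℝ) ^ k) ^ 3 = (1 / 8) ^ k := by
      rw [← pow_mul, mul_comm, pow_mul]; norm_num
    refine (measureReal_exists_link_ge_le hind hlaw (fun θ hθ => (hN1 (k + 1) θ hθ).1) hα
      (by positivity) (pow_le_one₀ (by norm_num) (by norm_num))
      (by rw [h8]; exact hKlt k hk)).trans ?_
    have e12 : (4096 : ℝ) ≤ Real.exp (17 / 2) := by
      have h1 : Real.exp (17 / 2) = Real.exp 1 ^ 8 * Real.exp (1 / 2) := by
        rw [← Real.exp_nat_mul, ← Real.exp_add]; norm_num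
      have h2 : (3 / 2 : ℝ) ≤ Real.exp (1 / 2) := by
        linarith [Real.add_one_le_exp (1 / 2 : ℝ)]
      have h3 : (2800 : ℝ) ≤ Real.exp 1 ^ 8 :=
        le_trans (by norm_num) (pow_le_pow_left₀ (by norm_num) e1 8)
      rw [h1]
      calc (4096 : ℝ) ≤ 2800 * (3 / 2) := by norm_num
        _ ≤ _ := by gcongr
    have hcard : ((N k).card : ℝ) * (N (k + 1)).card ≤ Real.exp (17 * D * (k + 1)) := by
      calc ((N k).card : ℝ) * (N (k + 1)).card
          ≤ (6 * 4096 ^ k) ^ Module.finrank ℝ E * (6 * 4096 ^ (k + 1)) ^ Module.finrank ℝ E := by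
            gcongr
            exacts [hNc k, hNc (k + 1)]
        _ = (36 * 4096 * (4096 ^ 2) ^ k) ^ Module.finrank ℝ E := by
            rw [← mul_pow]; congr 1; rw [← pow_mul]; ring
        _ ≤ (Real.exp 17 * Real.exp 17 ^ k) ^ Module.finrank ℝ E := by
            have h17 : Real.exp 17 = Real.exp (17 / 2) ^ 2 := by
              rw [← Real.exp_nat_mul]; norm_num
            have h17' : (4096 : ℝ) ^ 2 ≤ Real.exp 17 := by
              rw [h17]; exact pow_le_pow_left₀ (by norm_num) e12 2
            gcongr
            linarith
        _ = _ := by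
            rw [← pow_succ', ← pow_mul, ← Real.exp_nat_mul, hD]
            congr 1
            push_cast
            ring
    have h4 : (k : ℝ) + 1 ≤ 4 ^ k := by
      have := one_add_mul_le_pow (a := (3 : ℝ)) (by norm_num) k
      norm_num at this
      linarith [(Nat.cast_nonneg k : (0 : ℝ) ≤ k)]
    have hinv : m * α ^ 2 / (9216 * ((1 / 2 : ℝ) ^ k) ^ 2) = m * α ^ 2 / 9216 * 4 ^ k := by
      have h : ((1 / 2 : ℝ) ^ k) ^ 2 = (4 ^ k)⁻¹ := by
        rw [← pow_mul, mul_comm, pow_mul, ← inv_pow]; norm_num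
      rw [h]
      field_simp
    have hk0 : (0 : ℝ) ≤ k := Nat.cast_nonneg k
    -- `184320 = 20 · 9216`: of the factor `20`, `17` pays for the net cardinalities, and `3` for
    -- summability over `k`.
    have hexpo : 17 * D * (k + 1) - m * α ^ 2 / 9216 * 4 ^ k ≤ -3 * (k + 1) - l := by
      have h5 : 20 * (D + l) * (k + 1) ≤ m * α ^ 2 / 9216 * 4 ^ k := by
        refine mul_le_mul (by linarith) h4 (by positivity) (by positivity)
      nlinarith [mul_nonneg (sub_nonneg.2 hD1) (by positivity : (0 : ℝ) ≤ k + 1),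
        mul_nonneg hlogγ.le hk0]
    calc _ ≤ Real.exp (17 * D * (k + 1)) * Real.exp (-(m * α ^ 2 / 9216 * 4 ^ k)) := by
          rw [hinv]; gcongr
      _ = Real.exp (17 * D * (k + 1) - m * α ^ 2 / 9216 * 4 ^ k) := by
          rw [← Real.exp_add, sub_eq_add_neg]
      _ ≤ Real.exp (-3 * (k + 1) - l) := Real.exp_le_exp.2 hexpo
      _ = γ * Real.exp (-3) ^ (k + 1) := by
          rw [sub_eq_add_neg, Real.exp_add, hγexp, ← Real.exp_nat_mul, mul_comm]
          push_cast
          ring_nf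
      _ ≤ _ := by gcongr
  have hP1' : P.real (⋃ k ∈ Finset.range K, B1 k) ≤ γ / 7 := by
    refine (measureReal_biUnion_finset_le _ _).trans ?_
    refine (Finset.sum_le_sum fun k hk => hP1 k (Finset.mem_range.1 hk)).trans ?_
    have hgeom : ∀ n : ℕ, ∑ k ∈ Finset.range n, γ * (1 / 8 : ℝ) ^ (k + 1) =
        γ / 7 * (1 - (1 / 8) ^ n) := fun n => by
      induction n with
      | zero => simp
      | succ n ih => rw [Finset.sum_range_succ, ih, pow_succ]; ring
    rw [hgeom]
    refine mul_le_of_le_one_right (by positivity) ?_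
    linarith [pow_nonneg (by norm_num : (0 : ℝ) ≤ 1 / 8) K]
  set B : Set Ω := (B0 ∪ B2) ∪ ⋃ k ∈ Finset.range K, B1 k with hB
  have hPB : P.real B ≤ γ := by
    have h1 := measureReal_union_le (μ := P) (B0 ∪ B2) (⋃ k ∈ Finset.range K, B1 k)
    have h2 := measureReal_union_le (μ := P) B0 B2
    linarith
  -- `toMeasurable` avoids proving that `B` is measurable; it has the same measure.
  refine ⟨(toMeasurable P B)ᶜ, (measurableSet_toMeasurable P B).compl, ?_, ?_⟩
  · rw [probReal_compl_eq_one_sub (measurableSet_toMeasurable P B), measureReal_def,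
      measure_toMeasurable, ← measureReal_def]
    linarith
  · intro ω hω v hv q hq1
    have hωB : ω ∉ B := fun h => hω (subset_toMeasurable P B h)
    simp only [hB, Set.mem_union, not_or, Set.mem_iUnion, not_exists, Finset.mem_range] at hωB
    obtain ⟨⟨hω0, hω2⟩, hω1⟩ := hωB
    refine quantileCount_le_of_chain hα hα1 hN1 hN hK ?_ ?_ ?_ hv hq1
    · intro θ hθ
      by_contra hcon
      exact hω0 ⟨θ, hθ, (not_le.1 hcon).le⟩
    · intro k hk θ hθ θ' hθ' h1 h2
      by_contra hcon
      exact hω1 k hk ⟨θ, hθ, θ', hθ', h1, h2, (not_le.1 hcon).le⟩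
    · intro w
      by_contra hcon
      exact hω2 ⟨w, not_le.1 hcon⟩

end Uniform

/-! ### Reduction to the standard Gaussian. -/

section Whitening

open scoped MatrixOrder

variable {d : ℕ} {S : Matrix (Fin d) (Fin d) ℝ}

/-- The whitening map `S^{-1/2}`. -/
noncomputable def whitening (S : Matrix (Fin d) (Fin d) ℝ) :
    EuclideanSpace ℝ (Fin d) →L[ℝ] EuclideanSpace ℝ (Fin d) :=
  Matrix.toEuclideanCLM (𝕜 := ℝ) (CFC.sqrt S)⁻¹

theorem isUnit_det_sqrt (hS : S.PosDef) : IsUnit (CFC.sqrt S).det := by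
  have h : (CFC.sqrt S * CFC.sqrt S).det ≠ 0 := by
    rw [CFC.sqrt_mul_sqrt_self S hS.posSemidef.nonneg]
    exact hS.det_pos.ne'
  rw [Matrix.det_mul] at h
  exact isUnit_iff_ne_zero.2 (left_ne_zero_of_mul h)

theorem isHermitian_inv_sqrt (S : Matrix (Fin d) (Fin d) ℝ) : ((CFC.sqrt S)⁻¹).IsHermitian :=
  Matrix.IsHermitian.inv (CFC.sqrt_nonneg S).isSelfAdjoint

theorem whitening_sqrt_apply (hS : S.PosDef) (x : EuclideanSpace ℝ (Fin d)) :
    whitening S (Matrix.toEuclideanCLM (𝕜 := ℝ) (CFC.sqrt S) x) = x := by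
  rw [whitening, ← mul_apply_eq_comp, ← map_mul,
    Matrix.nonsing_inv_mul _ (isUnit_det_sqrt hS), map_one]
  rfl

theorem sqrt_whitening_apply (hS : S.PosDef) (x : EuclideanSpace ℝ (Fin d)) :
    Matrix.toEuclideanCLM (𝕜 := ℝ) (CFC.sqrt S) (whitening S x) = x := by
  rw [whitening, ← mul_apply_eq_comp, ← map_mul,
    Matrix.mul_nonsing_inv _ (isUnit_det_sqrt hS), map_one]
  rfl

theorem inner_whitening_right (x y : EuclideanSpace ℝ (Fin d)) :
    inner ℝ x (whitening S y) = inner ℝ (whitening S x) y := by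
  have h : IsSelfAdjoint (whitening S) :=
    (show IsSelfAdjoint ((CFC.sqrt S)⁻¹) from isHermitian_inv_sqrt S).map _
  rw [← ContinuousLinearMap.adjoint_inner_left, h.adjoint_eq]

theorem mahalanobisNorm_eq_norm_whitening (hS : S.PosDef) (x : EuclideanSpace ℝ (Fin d)) :
    mahalanobisNorm S x = ‖whitening S x‖ := by
  rw [mahalanobisNorm, norm_eq_sqrt_real_inner, inner_whitening_right, real_inner_comm]
  congr 1
  rw [whitening, ← mul_apply_eq_comp, ← map_mul, ← Matrix.mul_inv_rev,
    CFC.sqrt_mul_sqrt_self S hS.posSemidef.nonneg, Matrix.inner_toEuclideanCLM]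

theorem hasLaw_whitening {Ω : Type*} [MeasurableSpace Ω] {P : Measure Ω}
    {X : Ω → EuclideanSpace ℝ (Fin d)} {μ : EuclideanSpace ℝ (Fin d)} (hS : S.PosDef)
    (hX : HasLaw X (multivariateGaussian μ S) P) :
    HasLaw (fun ω => whitening S (X ω - μ)) (stdGaussian (EuclideanSpace ℝ (Fin d))) P := by
  have hm : Measurable fun x => whitening S (x - μ) := by fun_prop
  refine ⟨hm.comp_aemeasurable hX.aemeasurable, ?_⟩
  have h := AEMeasurable.map_map_of_aemeasurable (hm.aemeasurable (μ := P.map X)) hX.aemeasurable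
  rw [Function.comp_def] at h
  rw [← h, hX.map_eq, multivariateGaussian, Measure.map_map hm (by fun_prop)]
  convert Measure.map_id using 2
  ext1 x
  simp [whitening_sqrt_apply hS]

end Whitening

/-! ### Tukey depth and conclusion. -/

theorem tukeyDepth_le_countIn {d m : ℕ} (D : Fin m → EuclideanSpace ℝ (Fin d))
    {y v : EuclideanSpace ℝ (Fin d)} {t : ℝ} (hv : v ≠ 0) (hy : y ∈ closedHalfspace v t) :
    tukeyDepth D y ≤ countIn D (closedHalfspace v t) :=
  Nat.sInf_le ⟨v, t, hv, hy, rfl⟩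

theorem countIn_closedHalfspace_le_quantileCount {d m : ℕ} {S : Matrix (Fin d) (Fin d) ℝ}
    (D : Fin m → EuclideanSpace ℝ (Fin d)) (w μ : EuclideanSpace ℝ (Fin d)) (r : ℝ) :
    (countIn D (closedHalfspace (whitening S w) (r + inner ℝ (whitening S w) μ)) : ℝ) ≤
      quantileCount (fun i => whitening S (D i - μ)) (w, stdNormalCDF r) := by
  classical
  rw [countIn, quantileCount, Finset.card_filter, Nat.cast_sum]
  refine Finset.sum_le_sum fun i _ => ?_
  split_ifs with h
  · have hmem : whitening S (D i - μ) ∈ quantileHalfspace w (stdNormalCDF r) := by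
      refine stdNormalCDF_mono ?_
      rw [inner_whitening_right, inner_sub_right]
      exact le_sub_iff_add_le.2 h
    rw [Nat.cast_one, Set.indicator_of_mem hmem, Pi.one_apply]
  · simp only [Nat.cast_zero]
    exact Set.indicator_nonneg (fun _ _ => zero_le_one) _

theorem mainTheorem3 :
    ∃ c : ℝ, 0 < c ∧
      ∀ (d m : ℕ) (α γ : ℝ) (βstar : EuclideanSpace ℝ (Fin d)) (S : Matrix (Fin d) (Fin d) ℝ)
        (Ω : Type*) [MeasurableSpace Ω] (P : Measure Ω) [IsProbabilityMeasure P]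
        (β : Fin m → Ω → EuclideanSpace ℝ (Fin d)),
        1 ≤ d → 0 < α → α < 1 → 0 < γ → γ < 1 → S.PosDef →
        iIndepFun β P →
        (∀ i, HasLaw (β i) (multivariateGaussian βstar S) P) →
        c * (((d : ℝ) + Real.log (1 / γ)) / α ^ 2) ≤ (m : ℝ) →
        ∃ E : Set Ω, MeasurableSet E ∧ 1 - γ ≤ P.real E ∧
          ∀ ω ∈ E, ∀ (p : ℝ) (βhat : EuclideanSpace ℝ (Fin d)),
            p ≤ (tukeyDepth (fun i => β i ω) βhat : ℝ) →
            (mahalanobisNorm S (βhat - βstar) : EReal)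
              ≤ stdNormalQuantile (1 - p / (m : ℝ) + α) := by
  refine ⟨184320, by norm_num, ?_⟩
  intro d m α γ βstar S Ω _ P _ β hd hα hα1 hγ hγ1 hS hind hlaw hm
  have hmpos : (0 : ℝ) < m := by
    refine lt_of_lt_of_le ?_ hm
    have h1 : 0 < Real.log (1 / γ) :=
      Real.log_pos (by rw [one_div]; exact (one_lt_inv₀ hγ).2 hγ1)
    positivity
  have hfin : Module.finrank ℝ (EuclideanSpace ℝ (Fin d)) = d := by simp
  obtain ⟨G, hGm, hGP, hG⟩ := exists_event_quantileCount_le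
    (Z := fun i ω => whitening S (β i ω - βstar)) (by rw [hfin]; exact hd)
    (hind.comp (fun _ x => whitening S (x - βstar)) fun _ => by fun_prop)
    (fun i => hasLaw_whitening hS (hlaw i)) hα hα1 hγ hγ1 (by rw [hfin]; exact hm)
  refine ⟨G, hGm, hGP, fun ω hω p y hp => ?_⟩
  -- It suffices to bound the norm by each `x` in the set defining the quantile; an empty set gives
  -- `+∞` at no cost.
  refine le_sInf ?_
  rintro _ ⟨x, hx, rfl⟩
  rw [EReal.coe_le_coe_iff, mahalanobisNorm_eq_norm_whitening hS]
  by_contra! hcon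
  set z := whitening S (y - βstar) with hz
  -- The direction of `z`; for `z = 0` any unit vector serves, and one exists as `d ≥ 1`.
  obtain ⟨w, hw, hwz⟩ : ∃ w : EuclideanSpace ℝ (Fin d), ‖w‖ = 1 ∧ inner ℝ w z = ‖z‖ := by
    rcases eq_or_ne z 0 with h0 | h0
    · refine ⟨EuclideanSpace.single ⟨0, hd⟩ 1, by simp, by simp [h0]⟩
    · have hn := norm_ne_zero_iff.2 h0
      refine ⟨‖z‖⁻¹ • z, by rw [norm_smul, norm_inv, norm_norm, inv_mul_cancel₀ hn], ?_⟩
      rw [real_inner_smul_left, real_inner_self_eq_norm_sq, sq, inv_mul_cancel_left₀ hn]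
  have hv : whitening S w ≠ 0 := fun h => by
    have h1 := sqrt_whitening_apply hS w
    rw [h, map_zero] at h1
    rw [← h1, norm_zero] at hw
    exact zero_ne_one hw
  have hy : y ∈ closedHalfspace (whitening S w) (‖z‖ + inner ℝ (whitening S w) βstar) := by
    rw [hz, inner_whitening_right, inner_sub_right] at hwz
    exact (by linarith : ‖z‖ + inner ℝ (whitening S w) βstar ≤ inner ℝ (whitening S w) y)
  have h1 : (tukeyDepth (fun i => β i ω) y : ℝ) ≤ _ :=
    Nat.cast_le.2 (tukeyDepth_le_countIn (fun i => β i ω) hv hy)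
  have h2 := countIn_closedHalfspace_le_quantileCount (S := S) (fun i => β i ω) w βstar ‖z‖
  have h3 := hG ω hω w hw (stdNormalCDF ‖z‖) (stdNormalCDF_le_one _)
  -- Combined with `h5` this forces `α ≤ α/2`.
  have h4 : 1 - p / m + α ≤ stdNormalCDF ‖z‖ := hx.trans (stdNormalCDF_mono hcon.le)
  have h5 : p / m ≤ 1 - stdNormalCDF ‖z‖ + α / 2 := by
    rw [div_le_iff₀ hmpos, mul_comm]
    exact hp.trans (h1.trans (h2.trans h3))
  linarith
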